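/- Let $n=2p$, let $(M,g)$ be an $n$-dimensional oriented smooth Riemannian manifold, and take (positively oriented) Riemannian normal coordinates $x_1,\dots,x_n$ centred at a point $x\in M$. Let $\Gamma_{ij}^k$ be the Christoffel symbols of the Levi-Civita connection in these coordinates, and $R$ its curvature, regarded as an $n\times n$ matrix of two-forms $R^i{}_j=\frac12\sum_{k,l}R^i{}_{jkl}\,dx^k\wedge dx^l$, so that ${\rm tr}(R\wedge R)=\sum_{i,j}R^i{}_j\wedge R^j{}_i$. Let $S$ be the spinor module of $T_xM$, i.e. the complex Clifford module of dimension $2^p$ (with $c(v)^2=-|v|^2$), and put $\gamma_j=c(\partial_{x_j})$, $\sigma_{ij}=\frac18[\gamma_i,\gamma_j]$ and ${\rm str}(A)={\rm tr}(i^p\gamma_1\cdots\gamma_n A)$ for $A\in{\rm End}(S)$. For a polyhomogeneous symbol $\sigma(x,\xi)$ with values in ${\rm End}(S)$ and homogeneous component $\sigma_{-n}$ of degree $-n$, let $${\rm sres}_x(\sigma)=\frac1{(2\pi)^n}\int_{|\xi|=1}{\rm str}\big(\sigma_{-n}(x,\xi)\big)\,d\xi ,$$ where $d\xi$ is the surface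 measure of the unit sphere, and let $dx=dx^1\wedge\cdots\wedge dx^n$. All derivatives of Christoffel symbols below are taken at the centre $x$ of the coordinates, repeated indices are summed from $1$ to $n$, and the identities are between $n$-forms at $x$. (1) If $n=4$, then $${\rm sres}_x\!\left(|\xi|^{-4}\,\partial_{x_a}\Gamma_{ij}^k\,\partial_{x_a}\Gamma_{im}^l\,\sigma_{kj}\sigma_{lm}\right)dx=\frac{1}{32\pi^2}\,{\rm tr}(R\wedge R).$$ (2) If $n=4$, then $${\rm sres}_x\!\left(\frac{\xi_a\xi_b}{|\xi|^{6}}\,\partial_{x_a}\Gamma_{ij}^k\,\partial_{x_b}\Gamma_{im}^l\,\sigma_{kj}\sigma_{lm}\right)dx=\frac{1}{4\times 32\,\pi^2}\,{\rm tr}(R\wedge R).$$ (3) If $n=2p=4q$ with $q\ge1$, then $${\rm sres}_x\!\left(|\xi|^{-2p}\,\partial_{x_{a_1}}\Gamma_{i_1j_1}^{k_1}\partial_{x_{a_1}}\Gamma_{i_1m_1}^{l_1}\cdots\partial_{x_{a_q}}\Gamma_{i_qj_q}^{k_q}\partial_{x_{a_q}}\Gamma_{i_qm_q}^{l_q}\;\sigma_{k_1j_1}\sigma_{l_1m_1}\cdots\sigma_{k_qj_q}\sigma_{l_qm_q}\right)dx=\frac{1}{\Gamma(p)\,2^{3p-1}\,\pi^p}\,\big({\rm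 tr}(R\wedge R)\big)^q ,$$ where $\Gamma(p)=(p-1)!$ is the Gamma function and the power is the $q$-fold wedge product. -/

import Mathlib

open scoped Manifold ContDiff Bundle
open MeasureTheory

noncomputable section

namespace SuperResidue

/-! ## Riemannian geometry in a chart -/

section Geometry

/-- The model space `ℝⁿ`. -/
abbrev Coord (n : ℕ) : Type := EuclideanSpace ℝ (Fin n)

/-- The `i`-th standard basis vector of `ℝⁿ`. -/
def stdVec {n : ℕ} (i : Fin n) : Coord n := EuclideanSpace.single i 1

/-- The partial derivative `∂f/∂xₐ` of a function on `ℝⁿ`. -/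
def pd {n : ℕ} (a : Fin n) (f : Coord n → ℝ) (y : Coord n) : ℝ :=
  fderiv ℝ f y (stdVec a)

variable {n : ℕ} {M : Type*} [TopologicalSpace M] [ChartedSpace (Coord n) M]

/-- The coordinate vector field `∂/∂xᵢ` of the chart `φ`, at the point with coordinates `y`. -/
def coordVec (φ : OpenPartialHomeomorph M (Coord n)) (y : Coord n) (i : Fin n) :
    TangentSpace (𝓡 n) (φ.symm y) :=
  mfderiv 𝓘(ℝ, Coord n) (𝓡 n) φ.symm y (stdVec i)

/-- The coordinate differential `dxⁱ` of the chart `φ`, at the point with coordinates `y`, as a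
complex-valued covector. -/
def coordDiff (φ : OpenPartialHomeomorph M (Coord n)) (y : Coord n) (i : Fin n) :
    TangentSpace (𝓡 n) (φ.symm y) →ₗ[ℝ] ℂ :=
  Complex.ofRealCLM.toLinearMap ∘ₗ (EuclideanSpace.proj (𝕜 := ℝ) i).toLinearMap ∘ₗ
    (mfderiv (𝓡 n) 𝓘(ℝ, Coord n) φ (φ.symm y)).toLinearMap

variable [IsManifold (𝓡 n) ∞ M]

/-- A smooth Riemannian metric on `M`. -/
abbrev RiemMetric (n : ℕ) (M : Type*) [TopologicalSpace M] [ChartedSpace (Coord n) M]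
    [IsManifold (𝓡 n) ∞ M] :=
  Bundle.ContMDiffRiemannianMetric (𝓡 n) ∞ (Coord n) (fun x : M ↦ TangentSpace (𝓡 n) x)

/-- The matrix `(g_ij)` of the metric in the chart `φ`. -/
def metricMatrix (g : RiemMetric n M) (φ : OpenPartialHomeomorph M (Coord n)) (y : Coord n) :
    Matrix (Fin n) (Fin n) ℝ :=
  Matrix.of fun i j ↦ g.inner (φ.symm y) (coordVec φ y i) (coordVec φ y j)

/-- The Christoffel symbol
`Γ_ij^k = ½ ∑ₗ g^{kl} (∂_j g_il + ∂_i g_jl - ∂_l g_ij)` of the Levi-Civita connection. -/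
def christoffel (g : RiemMetric n M) (φ : OpenPartialHomeomorph M (Coord n))
    (i j k : Fin n) (y : Coord n) : ℝ :=
  (1 / 2) * ∑ l, (metricMatrix g φ y)⁻¹ k l *
    (pd j (fun z ↦ metricMatrix g φ z i l) y + pd i (fun z ↦ metricMatrix g φ z j l) y
      - pd l (fun z ↦ metricMatrix g φ z i j) y)

/-- The components `R^i_{jkl}` of the Riemann curvature tensor,
`R(∂_k, ∂_l) ∂_j = ∑ᵢ R^i_{jkl} ∂_i`. -/
def riemann (g : RiemMetric n M) (φ : OpenPartialHomeomorph M (Coord n))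
    (i j k l : Fin n) (y : Coord n) : ℝ :=
  pd k (christoffel g φ l j i) y - pd l (christoffel g φ k j i) y
    + ∑ m, (christoffel g φ k m i y * christoffel g φ l j m y
      - christoffel g φ l m i y * christoffel g φ k j m y)

/-- A curve, given in the coordinates of `φ`, is a geodesic on the set `s` of parameters:
`c''ᵏ + ∑ Γ_ij^k(c) c'ⁱ c'ʲ = 0`. -/
structure IsGeodesicInChart (g : RiemMetric n M) (φ : OpenPartialHomeomorph M (Coord n))
    (c : ℝ → Coord n) (s : Set ℝ) : Prop where
  mapsTo : ∀ t ∈ s, c t ∈ φ.target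
  contDiffOn : ContDiffOn ℝ 2 c s
  equation : ∀ t ∈ s, ∀ k : Fin n,
    deriv (deriv c) t k
      + ∑ i, ∑ j, christoffel g φ i j k (c t) * deriv c t i * deriv c t j = 0

/-- `φ` is a normal coordinate system for `g`, centred at the point `φ.symm 0`: it is a smooth
chart onto a star-shaped open set about `0`, its coordinate frame at the centre is orthonormal,
and the rays emanating from `0` are geodesics (so `φ.symm` is the exponential map at the centre,
after an isometric identification of the tangent space with `ℝⁿ`). -/
structure IsNormalChart (g : RiemMetric n M) (φ : OpenPartialHomeomorph M (Coord n)) : Prop where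
  mem_maximalAtlas : φ ∈ IsManifold.maximalAtlas (𝓡 n) ∞ M
  zero_mem_target : (0 : Coord n) ∈ φ.target
  starConvex_target : StarConvex ℝ 0 φ.target
  orthonormal : metricMatrix g φ 0 = 1
  geodesic_ray : ∀ v : Coord n,
    IsGeodesicInChart g φ (fun t ↦ t • v) {t : ℝ | t • v ∈ φ.target}

/-- The algebra of (complexified) differential forms at a point `x`, i.e. the exterior algebra
`Λ(T*ₓM ⊗ ℂ)`; the product is the wedge product. -/
abbrev FormsAt (n : ℕ) {M : Type*} [TopologicalSpace M] [ChartedSpace (Coord n) M] (x : M) :=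
  ExteriorAlgebra ℂ (TangentSpace (𝓡 n) x →ₗ[ℝ] ℂ)

/-- The one-form `dxⁱ` in the algebra of forms. -/
def dxForm (φ : OpenPartialHomeomorph M (Coord n)) (y : Coord n) (i : Fin n) :
    FormsAt n (φ.symm y) :=
  ExteriorAlgebra.ι ℂ (coordDiff φ y i)

/-- The volume form `dx = dx¹ ∧ ⋯ ∧ dxⁿ`. -/
def dxVol (φ : OpenPartialHomeomorph M (Coord n)) (y : Coord n) : FormsAt n (φ.symm y) :=
  (List.ofFn fun i : Fin n ↦ dxForm φ y i).prod

/-- The curvature `R` as an endomorphism-valued two-form: the matrix of two-forms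
`R^i_j = ½ ∑ R^i_{jkl} dxᵏ ∧ dxˡ`. -/
def curvatureForm (g : RiemMetric n M) (φ : OpenPartialHomeomorph M (Coord n)) (y : Coord n) :
    Matrix (Fin n) (Fin n) (FormsAt n (φ.symm y)) :=
  Matrix.of fun i j ↦ (1 / 2 : ℂ) •
    ∑ k, ∑ l, (riemann g φ i j k l y : ℂ) • (dxForm φ y k * dxForm φ y l)

/-- The four-form `tr(R ∧ R)`. -/
def trRR (g : RiemMetric n M) (φ : OpenPartialHomeomorph M (Coord n)) (y : Coord n) :
    FormsAt n (φ.symm y) :=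
  (curvatureForm g φ y * curvatureForm g φ y).trace

/-- The quadratic form `v ↦ -g(v, v)` on `TₓM`; its Clifford algebra is generated by `TₓM` with
the relations `c(v)² = -|v|²`. -/
def cliffordForm (g : RiemMetric n M) (x : M) : QuadraticForm ℝ (TangentSpace (𝓡 n) x) :=
  -(LinearMap.BilinMap.toQuadraticMap (g.inner x).toLinearMap₁₂)

/-- The Clifford algebra `C(TₓM)`. -/
abbrev CliffordAt (g : RiemMetric n M) (x : M) := CliffordAlgebra (cliffordForm g x)

/-- The Clifford matrices `γ_j = c(∂_j)` of the coordinate frame of `φ` at the point with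
coordinates `y`, acting on the Clifford module `S` by the representation `ρ`. -/
def gammaMatrix (g : RiemMetric n M) (φ : OpenPartialHomeomorph M (Coord n)) (y : Coord n)
    {S : Type*} [AddCommGroup S] [Module ℂ S]
    (ρ : CliffordAt g (φ.symm y) →ₐ[ℝ] Module.End ℂ S) (j : Fin n) : Module.End ℂ S :=
  ρ (CliffordAlgebra.ι (cliffordForm g (φ.symm y)) (coordVec φ y j))

end Geometry

/-! ## Spinors and the super trace -/

section Spinors

variable {n : ℕ} {S : Type*} [AddCommGroup S] [Module ℂ S]

/-- The grading operator `i^p γ₁ ⋯ γₙ`, where `n = 2p`. -/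
def grading (p : ℕ) (γ : Fin n → Module.End ℂ S) : Module.End ℂ S :=
  Complex.I ^ p • (List.ofFn γ).prod

/-- The super trace, `str(A) = tr(i^p γ₁ ⋯ γₙ A)`. -/
def superTrace (p : ℕ) (γ : Fin n → Module.End ℂ S) (A : Module.End ℂ S) : ℂ :=
  LinearMap.trace ℂ S (grading p γ * A)

/-- `σ_ij = ⅛ [γ_i, γ_j]`. -/
def spinSigma (γ : Fin n → Module.End ℂ S) (i j : Fin n) : Module.End ℂ S :=
  (1 / 8 : ℂ) • (γ i * γ j - γ j * γ i)

end Spinors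

/-! ## Polyhomogeneous symbols and the residue -/

section Symbols

/-- A polyhomogeneous (formal classical) symbol of integral order at a fixed point, with values in
the finite-dimensional algebra `A`: the formal sum over `d` of its positively homogeneous
components of degree `d`, which are smooth outside `ξ = 0` and vanish for large `d`. -/
structure FormalSymbol (n : ℕ) (A : Type*) [AddCommGroup A] [Module ℝ A] where
  comp : ℤ → Coord n → A
  homogeneous : ∀ (d : ℤ) (t : ℝ) (ξ : Coord n), 0 < t → ξ ≠ 0 →
    comp d (t • ξ) = t ^ d • comp d ξ
  smooth : ∀ (d : ℤ) (l : A →ₗ[ℝ] ℝ), ContDiffOn ℝ ∞ (fun ξ ↦ l (comp d ξ)) {0}ᶜ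
  order : ∃ m : ℤ, ∀ d, m < d → comp d = 0

variable {n : ℕ} {A : Type*} [AddCommGroup A] [Module ℝ A]

theorem contDiffOn_norm_zpow (d : ℤ) :
    ContDiffOn ℝ ∞ (fun ξ : Coord n ↦ ‖ξ‖ ^ d) {0}ᶜ := by
  have h1 : ContDiffOn ℝ ∞ (fun ξ : Coord n ↦ ‖ξ‖) {0}ᶜ := fun ξ hξ ↦
    (contDiffAt_norm ℝ hξ).contDiffWithinAt
  cases d with
  | ofNat m => simpa using h1.pow m
  | negSucc m =>
    simp only [zpow_negSucc]
    exact (h1.pow (m + 1)).inv fun ξ hξ ↦ pow_ne_zero _ (norm_ne_zero_iff.2 hξ)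

/-- The symbol `|ξ|^d B`, homogeneous of degree `d`. -/
def normPowSymbol (d : ℤ) (B : A) : FormalSymbol n A where
  comp m ξ := if m = d then ‖ξ‖ ^ d • B else 0
  homogeneous m t ξ ht _ := by
    by_cases h : m = d
    · subst h
      simp [norm_smul, abs_of_pos ht, mul_zpow, smul_smul]
    · simp [h]
  smooth m l := by
    by_cases h : m = d
    · simpa [h] using (contDiffOn_norm_zpow d).mul contDiffOn_const
    · simpa [h] using contDiffOn_const
  order := ⟨d, fun m hm ↦ by funext ξ; simp [hm.ne']⟩

/-- The symbol `∑_{a,b} ξ_a ξ_b |ξ|^d B_ab`, homogeneous of degree `d + 2`. -/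
def quadNormPowSymbol (d : ℤ) (B : Fin n → Fin n → A) : FormalSymbol n A where
  comp m ξ := if m = d + 2 then ∑ a, ∑ b, (ξ a * ξ b * ‖ξ‖ ^ d) • B a b else 0
  homogeneous m t ξ ht _ := by
    by_cases h : m = d + 2
    · subst h
      simp only [if_true, Finset.smul_sum, smul_smul]
      refine Finset.sum_congr rfl fun a _ ↦ Finset.sum_congr rfl fun b _ ↦ ?_
      congr 1
      rw [norm_smul, Real.norm_of_nonneg ht.le, mul_zpow, zpow_add₀ ht.ne']
      simp only [PiLp.smul_apply, smul_eq_mul]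
      norm_cast
      ring
    · simp [h]
  smooth m l := by
    by_cases h : m = d + 2
    · simp only [h, if_true, map_sum, map_smul, smul_eq_mul]
      refine ContDiffOn.sum fun a _ ↦ ContDiffOn.sum fun b _ ↦ ?_
      have hc : ∀ i : Fin n, ContDiffOn ℝ ∞ (fun ξ : Coord n ↦ ξ i) {0}ᶜ := fun i ↦
        (EuclideanSpace.proj i : Coord n →L[ℝ] ℝ).contDiff.contDiffOn
      exact (((hc a).mul (hc b)).mul (contDiffOn_norm_zpow d)).mul contDiffOn_const
    · simpa [h] using contDiffOn_const
  order := ⟨d + 2, fun m hm ↦ by funext ξ; simp [hm.ne']⟩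

/-- The super residue
`sresₓ(σ) = (2π)⁻ⁿ ∫_{|ξ| = 1} str(σ_{-n}(x, ξ)) dξ`, where `σ_{-n}` is the homogeneous component
of degree `-n` and `dξ` is the surface measure of the unit sphere. -/
def sres (p : ℕ) {S : Type*} [AddCommGroup S] [Module ℂ S] (γ : Fin n → Module.End ℂ S)
    (σ : FormalSymbol n (Module.End ℂ S)) : ℂ :=
  1 / (2 * (Real.pi : ℂ)) ^ n *
    ∫ ξ : Metric.sphere (0 : Coord n) 1, superTrace p γ (σ.comp (-(n : ℤ)) ξ)
      ∂(volume : Measure (Coord n)).toSphere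

end Symbols

end SuperResidue

end

/-! In normal coordinates `∂_aΓ_ij^k - ∂_aΓ_ik^j = R^k_jai` at the centre
(`pd_christoffel_sub_swap`). Since `σ_kj` is antisymmetric, contracting `∂_aΓ_ij^k` with it sees
only this difference, so the endomorphism is `1/64` of `∑_{a,i} (∑ R_kjai γ_k γ_j)²`. By the pair
symmetry and antisymmetry of the curvature, `tr(R ∧ R)` is `-1/4` of the same polynomial with `dxᵏ`
in place of `γ_k` (`trRR_eq`).

The two evaluations are compared in the free algebra. On homogeneous elements of degree `n`, the
super trace picks out the top exterior coefficient up to the constant `str(γ₁⋯γₙ)`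
(`superTrace_lift_smul`), which is `(-4)^q` for `n = 4q`. The constants combine to `(-4/64)^q (-4)^q
= 2^{-p}`.

The remaining factor is the volume of the unit sphere over `(2π)ⁿ`; for the quadratic symbol, `ξ_a
ξ_b` averages to `δ_ab / n`, which produces the extra `1/4`. -/

namespace SuperResidue

/-! ### Words in anticommuting letters. -/

section CliffordWords

variable {ι A : Type*} [DecidableEq ι] [Ring A] {γ : ι → A}

/-- Each letter other than `i` contributes a sign and each copy of `i` none; `length + count` has
the parity of `length - count`. -/
theorem mul_prod_map_of_anticomm (hanti : ∀ i j, i ≠ j → γ i * γ j = -(γ j * γ i)) (i : ι)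
    (l : List ι) :
    γ i * (l.map γ).prod = (-1) ^ (l.length + l.count i) * ((l.map γ).prod * γ i) := by
  induction l with
  | nil => simp
  | cons a l ih =>
    by_cases h : a = i
    · subst h
      simp only [List.map_cons, List.prod_cons, List.length_cons, List.count_cons_self]
      rw [show l.length + 1 + (l.count a + 1) = (l.length + l.count a) + 2 by ring, pow_add]
      have := (Commute.neg_one_left (γ a)).pow_left (l.length + l.count a)
      rw [mul_assoc (γ a) (List.prod _), ih, ← mul_assoc, ← this.eq]
      simp [mul_assoc]
    · simp only [List.map_cons, List.prod_cons, List.length_cons, List.count_cons_of_ne h]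
      rw [show l.length + 1 + l.count i = (l.length + l.count i) + 1 by ring, pow_succ,
        ← mul_assoc, hanti i a (Ne.symm h), neg_mul, mul_assoc, ih]
      have := (Commute.neg_one_left (γ a)).pow_left (l.length + l.count i)
      rw [← mul_assoc, ← this.eq]
      simp [mul_assoc]

/-- Moving the second copy of the leading letter back to the first costs `(-1)^length`, and its
square costs one more sign; the exponents add up to a triangular number. -/
theorem prod_map_mul_self_of_nodup (hanti : ∀ i j, i ≠ j → γ i * γ j = -(γ j * γ i))
    (hsq : ∀ i, γ i * γ i = -1) {l : List ι} (hl : l.Nodup) :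
    (l.map γ).prod * (l.map γ).prod = (-1) ^ ∑ i ∈ Finset.range (l.length + 1), i := by
  induction l with
  | nil => simp
  | cons a l ih =>
    rw [List.nodup_cons] at hl
    have h := mul_prod_map_of_anticomm hanti a l
    rw [List.count_eq_zero_of_not_mem hl.1, add_zero] at h
    have hc := (Commute.neg_one_left ((l.map γ).prod)).pow_left l.length
    rw [List.map_cons, List.prod_cons, List.length_cons, Finset.sum_range_succ, pow_add,
      ← ih hl.2]
    nth_rewrite 1 [h]
    calc _ = (-1) ^ l.length * ((l.map γ).prod * (γ a * γ a) * (l.map γ).prod) := by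
          simp only [mul_assoc]
      _ = (-1) ^ l.length * (-1) * ((l.map γ).prod * (l.map γ).prod) := by
          rw [hsq]; simp
      _ = _ := by
          rw [← pow_succ]
          exact ((Commute.neg_one_left _).pow_left _).eq

/-- A permutation of the letters changes the products of two anticommuting families by the same
sign. -/
theorem exists_sign_of_perm {B : Type*} [Ring B] {θ : ι → B}
    (hγ : ∀ i j, i ≠ j → γ i * γ j = -(γ j * γ i)) (hθ : ∀ i j, i ≠ j → θ i * θ j = -(θ j * θ i))
    {l l' : List ι} (h : l.Perm l') :
    ∃ ε : ℤˣ, (l.map γ).prod = ((ε : ℤ) : A) * (l'.map γ).prod ∧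
      (l.map θ).prod = ((ε : ℤ) : B) * (l'.map θ).prod := by
  induction h with
  | nil => exact ⟨1, by simp⟩
  | cons a _ ih =>
    obtain ⟨ε, h1, h2⟩ := ih
    refine ⟨ε, ?_, ?_⟩
    · simp only [List.map_cons, List.prod_cons, h1]
      rw [← mul_assoc, ← (Int.cast_commute _ _).eq, mul_assoc]
    · simp only [List.map_cons, List.prod_cons, h2]
      rw [← mul_assoc, ← (Int.cast_commute _ _).eq, mul_assoc]
  | swap a b l =>
    by_cases hab : a = b
    · subst hab
      exact ⟨1, by simp⟩
    · refine ⟨-1, ?_, ?_⟩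
      · simp [← mul_assoc, hγ a b hab]
      · simp [← mul_assoc, hθ a b hab]
  | trans _ _ ih1 ih2 =>
    obtain ⟨ε, h1, h2⟩ := ih1
    obtain ⟨ε', h1', h2'⟩ := ih2
    exact ⟨ε * ε', by simp [h1, h1', mul_assoc], by simp [h2, h2', mul_assoc]⟩

theorem prod_map_eq_zero_of_duplicate {θ : ι → A} (hθ : ∀ i j, i ≠ j → θ i * θ j = -(θ j * θ i))
    (hsq : ∀ i, θ i * θ i = 0) {l : List ι} (hl : ¬ l.Nodup) : (l.map θ).prod = 0 := by
  induction l with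
  | nil => simp at hl
  | cons a l ih =>
    rw [List.map_cons, List.prod_cons]
    by_cases ha : a ∈ l
    · obtain ⟨ε, h, -⟩ := exists_sign_of_perm hθ hθ (List.perm_cons_erase ha)
      rw [h, ← mul_assoc, ← (Int.cast_commute _ _).eq, List.map_cons, List.prod_cons, mul_assoc,
        ← mul_assoc (θ a), hsq]
      simp
    · rw [ih (by simpa [List.nodup_cons, ha] using hl), mul_zero]

end CliffordWords

/-! ### The super trace as a Berezin integral. -/

section Trace

variable {n : ℕ} {S : Type*} [AddCommGroup S] [Module ℂ S] {γ : Fin n → Module.End ℂ S}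

theorem perm_finRange_of_nodup {l : List (Fin n)} (hl : l.Nodup) (hn : l.length = n) :
    l.Perm (List.finRange n) := by
  refine (List.perm_of_nodup_nodup_toFinset_eq hl (List.nodup_finRange n) ?_)
  rw [List.toFinset_finRange, ← Finset.card_eq_iff_eq_univ, List.toFinset_card_of_nodup hl, hn,
    Fintype.card_fin]

theorem exists_not_mem_of_not_nodup {l : List (Fin n)} (hl : ¬ l.Nodup) (hn : l.length = n) :
    ∃ i, i ∉ l := by
  by_contra! h
  have hu : (l : Multiset (Fin n)).toFinset = Finset.univ :=
    Finset.eq_univ_iff_forall.2 fun i ↦ by simpa using h i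
  refine hl (Multiset.coe_nodup.1 (Multiset.toFinset_card_eq_card_iff_nodup.1 ?_))
  rw [hu]
  simp [hn]

/-- For even `n`, a missing `γ_i` anticommutes with `γ₁⋯γₙ` but commutes with the even word.
Cyclicity of the trace, with `γ_i² = -1`, then makes the trace equal to its own negative. -/
theorem superTrace_prod_map_eq_zero (hanti : ∀ i j, i ≠ j → γ i * γ j = -(γ j * γ i))
    (hsq : ∀ i, γ i * γ i = -1) (hn : Even n) (p : ℕ) {l : List (Fin n)} (hl : Even l.length)
    {i : Fin n} (hi : i ∉ l) : superTrace p γ (l.map γ).prod = 0 := by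
  have h1 := mul_prod_map_of_anticomm hanti i l
  have h2 := mul_prod_map_of_anticomm hanti i (List.finRange n)
  rw [List.count_eq_zero_of_not_mem hi, add_zero, hl.neg_one_pow, one_mul] at h1
  rw [List.count_eq_one_of_mem (List.nodup_finRange n) (List.mem_finRange i), List.length_finRange,
    pow_succ, hn.neg_one_pow, ← List.ofFn_eq_map] at h2
  set G := (List.ofFn γ).prod
  set P := (l.map γ).prod
  have key : LinearMap.trace ℂ S (G * P) = 0 := by
    have e1 : LinearMap.trace ℂ S (γ i * (G * P * γ i)) = LinearMap.trace ℂ S (G * P * γ i * γ i) :=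
      LinearMap.trace_mul_comm ℂ _ _
    have e2 : γ i * (G * P * γ i) = G * P := by
      calc γ i * (G * P * γ i) = (γ i * G) * P * γ i := by simp only [mul_assoc]
        _ = -(G * (γ i * P) * γ i) := by rw [h2]; simp [mul_assoc]
        _ = -(G * P * (γ i * γ i)) := by rw [h1]; simp only [mul_assoc]
        _ = _ := by rw [hsq]; simp
    rw [e2, mul_assoc _ (γ i), hsq, mul_neg, mul_one, map_neg] at e1
    exact self_eq_neg.1 e1
  rw [superTrace, grading, smul_mul_assoc, map_smul]
  exact (congrArg _ key).trans (smul_zero _)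

/-- For `n = 4q` the square of `γ₁⋯γₙ` is `+1`, as `n(n+1)/2` is even, so the value is `i^{2q} dim S
= (-1)^q 4^q`. -/
theorem superTrace_prod_ofFn (hanti : ∀ i j, i ≠ j → γ i * γ j = -(γ j * γ i))
    (hsq : ∀ i, γ i * γ i = -1) {q p : ℕ} (hn : n = 4 * q) (hp : p = 2 * q)
    (hS : Module.finrank ℂ S = 2 ^ p) :
    superTrace p γ (List.ofFn γ).prod = (-4) ^ q := by
  have : Module.Finite ℂ S := Module.finite_of_finrank_pos (by rw [hS]; positivity)
  have : Even (∑ i ∈ Finset.range (n + 1), i) := by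
    have := Finset.sum_range_id_mul_two (n + 1)
    refine ⟨q * (n + 1), ?_⟩
    rw [Nat.add_sub_cancel] at this
    have h4 : (n + 1) * n = (q * (n + 1) + q * (n + 1)) * 2 := by
      rw [hn]; ring
    omega
  have h := prod_map_mul_self_of_nodup hanti hsq (List.nodup_finRange n)
  rw [List.length_finRange, this.neg_one_pow, ← List.ofFn_eq_map] at h
  rw [superTrace, grading, smul_mul_assoc, h, map_smul, LinearMap.trace_one, hS, hp, pow_mul,
    Complex.I_sq, smul_eq_mul, pow_mul]
  push_cast
  rw [← mul_pow]
  norm_num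

/-- In the top degree, the super trace of a Clifford word is proportional to the corresponding
exterior word. -/
theorem superTrace_smul_prod_ofFn {E : Type*} [Ring E] [Algebra ℂ E] {θ : Fin n → E}
    (hanti : ∀ i j, i ≠ j → γ i * γ j = -(γ j * γ i)) (hsq : ∀ i, γ i * γ i = -1)
    (hθ : ∀ i j, i ≠ j → θ i * θ j = -(θ j * θ i)) (hθsq : ∀ i, θ i * θ i = 0)
    (hn : Even n) (p : ℕ) {l : List (Fin n)} (hl : l.length = n) :
    superTrace p γ (l.map γ).prod • (List.ofFn θ).prod
      = superTrace p γ (List.ofFn γ).prod • (l.map θ).prod := by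
  by_cases hd : l.Nodup
  · obtain ⟨ε, h1, h2⟩ := exists_sign_of_perm hanti hθ (perm_finRange_of_nodup hd hl)
    rw [← List.ofFn_eq_map, ← zsmul_eq_mul] at h1 h2
    rw [h1, h2, superTrace, superTrace, mul_smul_comm, map_zsmul, smul_assoc, smul_comm]
  -- A word of length `n` with a repetition omits some letter. The Clifford word itself need not
  -- vanish, but its super trace does.
  · obtain ⟨i, hi⟩ := exists_not_mem_of_not_nodup hd hl
    rw [superTrace_prod_map_eq_zero hanti hsq hn p (hl.symm ▸ hn) hi,
      prod_map_eq_zero_of_duplicate hθ hθsq hd, zero_smul, smul_zero]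

/-- The super trace as a linear form. -/
noncomputable def superTraceₗ (p : ℕ) (γ : Fin n → Module.End ℂ S) : Module.End ℂ S →ₗ[ℂ] ℂ :=
  LinearMap.trace ℂ S ∘ₗ LinearMap.mulLeft ℂ (grading p γ)

theorem superTraceₗ_apply (p : ℕ) (γ : Fin n → Module.End ℂ S) (A : Module.End ℂ S) :
    superTraceₗ p γ A = superTrace p γ A := rfl

theorem lift_prod_ofFn_ι {X A : Type*} [Ring A] [Algebra ℂ A] (η : X → A) {m : ℕ} (s : Fin m → X) :
    FreeAlgebra.lift ℂ η (List.ofFn fun r ↦ FreeAlgebra.ι ℂ (s r)).prod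
      = ((List.ofFn s).map η).prod := by
  rw [map_list_prod, List.map_ofFn, List.map_ofFn]
  congr 2
  ext r
  simp

/-- The word-by-word comparison extends linearly. The free algebra lets one polynomial be evaluated
both at Clifford matrices and at one-forms. -/
theorem superTrace_lift_smul {E : Type*} [Ring E] [Algebra ℂ E] {θ : Fin n → E}
    (hanti : ∀ i j, i ≠ j → γ i * γ j = -(γ j * γ i)) (hsq : ∀ i, γ i * γ i = -1)
    (hθ : ∀ i j, i ≠ j → θ i * θ j = -(θ j * θ i)) (hθsq : ∀ i, θ i * θ i = 0)
    (hn : Even n) (p : ℕ) {w : FreeAlgebra ℂ (Fin n)}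
    (hw : w ∈ Submodule.span ℂ (Set.range (FreeAlgebra.ι ℂ : Fin n → _)) ^ n) :
    superTrace p γ (FreeAlgebra.lift ℂ γ w) • (List.ofFn θ).prod
      = superTrace p γ (List.ofFn γ).prod • FreeAlgebra.lift ℂ θ w := by
  rw [Submodule.span_pow] at hw
  induction hw using Submodule.span_induction with
  | mem x hx =>
    obtain ⟨f, rfl⟩ := Set.mem_pow.1 hx
    choose s hs using fun r ↦ (f r).2
    simp only [← hs]
    rw [lift_prod_ofFn_ι, lift_prod_ofFn_ι]
    exact superTrace_smul_prod_ofFn hanti hsq hθ hθsq hn p (by simp)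
  | zero => simp [superTrace]
  | add x y _ _ hx hy =>
    simp only [← superTraceₗ_apply] at hx hy ⊢
    rw [map_add, map_add, map_add, add_smul, smul_add, hx, hy]
  | smul c x _ hx =>
    simp only [← superTraceₗ_apply] at hx ⊢
    rw [map_smul, map_smul, map_smul, smul_assoc, hx, smul_comm]

end Trace

/-- A power of a sum is the sum of the products of all words in the summands. -/
theorem sum_pow_eq_sum_prod_ofFn {X A : Type*} [Fintype X] [Semiring A] (F : X → A) (q : ℕ) :
    (∑ x, F x) ^ q = ∑ x : Fin q → X, (List.ofFn fun r ↦ F (x r)).prod := by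
  induction q with
  | zero => simp
  | succ q ih =>
    rw [pow_succ', ih, ← (Fin.consEquiv fun _ ↦ X).sum_comp, Fintype.sum_prod_type,
      Finset.sum_mul_sum]
    simp [List.ofFn_succ, Fin.consEquiv]


/-! ### Smoothness of the metric coefficients. -/

section Smooth
variable {n : ℕ} {M : Type*} [TopologicalSpace M] [ChartedSpace (Coord n) M]
  [IsManifold (𝓡 n) ∞ M]

/-- The coordinate field is the tangent map of the smooth `φ.symm` applied to a constant section. -/
theorem contMDiffOn_coordVec {φ : OpenPartialHomeomorph M (Coord n)}
    (hφ : φ ∈ IsManifold.maximalAtlas (𝓡 n) ∞ M) (i : Fin n) :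
    ContMDiffOn 𝓘(ℝ, Coord n) (𝓡 n).tangent ∞
      (fun y ↦ (⟨φ.symm y, coordVec φ y i⟩ : TangentBundle (𝓡 n) M)) φ.target := by
  have h1 : ContMDiffOn 𝓘(ℝ, Coord n) (𝓡 n) ∞ φ.symm φ.target :=
    contMDiffOn_symm_of_mem_maximalAtlas hφ
  have h2 := h1.contMDiffOn_tangentMapWithin (m := ∞) le_rfl φ.open_target.uniqueMDiffOn
  have h3 : ContMDiff 𝓘(ℝ, Coord n) 𝓘(ℝ, Coord n).tangent ∞
      (fun y ↦ (⟨y, stdVec i⟩ : TangentBundle 𝓘(ℝ, Coord n) (Coord n))) :=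
    contMDiff_vectorSpace_iff_contDiff.2 contDiff_const
  refine (h2.comp h3.contMDiffOn (s := φ.target) fun y hy ↦ hy).congr fun y hy ↦ ?_
  simp only [Function.comp, tangentMapWithin, coordVec]
  rw [mfderivWithin_of_isOpen φ.open_target hy]

theorem contDiffOn_metricMatrix (g : RiemMetric n M) {φ : OpenPartialHomeomorph M (Coord n)}
    (hφ : φ ∈ IsManifold.maximalAtlas (𝓡 n) ∞ M) (i j : Fin n) :
    ContDiffOn ℝ ∞ (fun y ↦ metricMatrix g φ y i j) φ.target := by
  rw [← contMDiffOn_iff_contDiffOn]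
  intro y hy
  have hb : ContMDiffOn 𝓘(ℝ, Coord n) (𝓡 n) ∞ φ.symm φ.target :=
    contMDiffOn_symm_of_mem_maximalAtlas hφ
  have : ContMDiffWithinAt 𝓘(ℝ, Coord n) ((𝓡 n).prod 𝓘(ℝ)) ∞
      (fun y ↦ Bundle.TotalSpace.mk' ℝ (E := Bundle.Trivial M ℝ) (φ.symm y)
        (g.inner (φ.symm y) (coordVec φ y i) (coordVec φ y j))) φ.target y := by
    apply ContMDiffWithinAt.clm_bundle_apply₂ (F₁ := Coord n) (F₂ := Coord n)
    · exact ContMDiffAt.comp_contMDiffWithinAt y g.contMDiff.contMDiffAt (hb y hy)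
    · exact contMDiffOn_coordVec hφ i y hy
    · exact contMDiffOn_coordVec hφ j y hy
  simp only [Bundle.contMDiffWithinAt_totalSpace] at this
  exact this.2
end Smooth

/-! ### Calculus of partial derivatives. -/

section PartialDerivatives
variable {n : ℕ} {f f' : Coord n → ℝ} {y : Coord n}

theorem pd_add (hf : DifferentiableAt ℝ f y) (hf' : DifferentiableAt ℝ f' y) (a : Fin n) :
    pd a (fun z ↦ f z + f' z) y = pd a f y + pd a f' y := by
  simp [pd, fderiv_fun_add hf hf']

theorem pd_sub (hf : DifferentiableAt ℝ f y) (hf' : DifferentiableAt ℝ f' y) (a : Fin n) :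
    pd a (fun z ↦ f z - f' z) y = pd a f y - pd a f' y := by
  simp [pd, fderiv_fun_sub hf hf']

theorem pd_mul (hf : DifferentiableAt ℝ f y) (hf' : DifferentiableAt ℝ f' y) (a : Fin n) :
    pd a (fun z ↦ f z * f' z) y = f y * pd a f' y + f' y * pd a f y := by
  simp [pd, fderiv_fun_mul hf hf']

theorem pd_const_mul (hf : DifferentiableAt ℝ f y) (c : ℝ) (a : Fin n) :
    pd a (fun z ↦ c * f z) y = c * pd a f y := by
  simp [pd, fderiv_const_mul hf]

theorem pd_sum {ι : Type*} {s : Finset ι} {F : ι → Coord n → ℝ}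
    (hF : ∀ i ∈ s, DifferentiableAt ℝ (F i) y) (a : Fin n) :
    pd a (fun z ↦ ∑ i ∈ s, F i z) y = ∑ i ∈ s, pd a (F i) y := by
  simp [pd, fderiv_fun_sum hF]

theorem _root_.ContDiffAt.pd (hf : ContDiffAt ℝ ∞ f y) (a : Fin n) :
    ContDiffAt ℝ ∞ (SuperResidue.pd a f) y :=
  (hf.fderiv_right (m := ∞) le_rfl).clm_apply contDiffAt_const

theorem pd_comm (hf : ContDiffAt ℝ ∞ f y) (a b : Fin n) : pd a (pd b f) y = pd b (pd a f) y := by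
  have hd : DifferentiableAt ℝ (fderiv ℝ f) y :=
    (hf.fderiv_right (m := ∞) le_rfl).differentiableAt (by simp)
  have h : ∀ a b : Fin n, pd a (pd b f) y = fderiv ℝ (fderiv ℝ f) y (stdVec a) (stdVec b) := by
    intro a b
    have := (hd.hasFDerivAt.clm_apply (hasFDerivAt_const (stdVec b) y)).fderiv
    unfold pd
    rw [this]
    simp
  rw [h, h]
  exact (hf.isSymmSndFDerivAt (by simpa using ENat.LEInfty.out)) _ _

theorem fderiv_apply_eq_sum_pd (v : Coord n) : fderiv ℝ f y v = ∑ a, v a * pd a f y := by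
  conv_lhs => rw [← (EuclideanSpace.basisFun (Fin n) ℝ).sum_repr v]
  simp [pd, stdVec]

end PartialDerivatives

/-! ### Polarization of quadratic and cubic forms. -/

section Polarization
variable {n : ℕ}

theorem add_swap_eq_zero_of_quadratic {T : Fin n → Fin n → ℝ}
    (h : ∀ v : Coord n, ∑ i, ∑ j, T i j * v i * v j = 0) (i j : Fin n) : T i j + T j i = 0 := by
  let B : Coord n → Coord n → ℝ := fun u v ↦ ∑ i, ∑ j, T i j * u i * v j
  have hl : ∀ u u' v, B (u + u') v = B u v + B u' v := fun u u' v ↦ by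
    simp only [B, PiLp.add_apply, mul_add, add_mul, Finset.sum_add_distrib]
  have hr : ∀ u v v', B u (v + v') = B u v + B u v' := fun u v v' ↦ by
    simp only [B, PiLp.add_apply, mul_add, Finset.sum_add_distrib]
  have he : ∀ i j, B (stdVec i) (stdVec j) = T i j := fun i j ↦ by simp [B, stdVec]
  have h0 : ∀ v, B v v = 0 := h
  have h1 := h0 (stdVec i + stdVec j)
  simp only [hl, hr] at h1
  rw [← he, ← he]
  linarith [h0 (stdVec i), h0 (stdVec j)]

theorem symmetrization_eq_zero_of_cubic {T : Fin n → Fin n → Fin n → ℝ}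
    (h : ∀ v : Coord n, ∑ a, ∑ i, ∑ j, T a i j * v a * v i * v j = 0) (a i j : Fin n) :
    T a i j + T a j i + T i a j + T i j a + T j a i + T j i a = 0 := by
  let B : Coord n → Coord n → Coord n → ℝ := fun u v w ↦
    ∑ a, ∑ i, ∑ j, T a i j * u a * v i * w j
  have h₁ : ∀ u u' v w, B (u + u') v w = B u v w + B u' v w := fun u u' v w ↦ by
    simp only [B, PiLp.add_apply, mul_add, add_mul, Finset.sum_add_distrib]
  have h₂ : ∀ u v v' w, B u (v + v') w = B u v w + B u v' w := fun u v v' w ↦ by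
    simp only [B, PiLp.add_apply, mul_add, add_mul, Finset.sum_add_distrib]
  have h₃ : ∀ u v w w', B u v (w + w') = B u v w + B u v w' := fun u v w w' ↦ by
    simp only [B, PiLp.add_apply, mul_add, Finset.sum_add_distrib]
  have he : ∀ a i j, B (stdVec a) (stdVec i) (stdVec j) = T a i j := fun a i j ↦ by
    simp [B, stdVec]
  have h0 : ∀ v, B v v v = 0 := h
  -- Inclusion–exclusion over the sums of subsets of the three basis vectors isolates the fully
  -- mixed terms.
  have e1 := h0 (stdVec a + stdVec i + stdVec j)
  have e2 := h0 (stdVec a + stdVec i)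
  have e3 := h0 (stdVec a + stdVec j)
  have e4 := h0 (stdVec i + stdVec j)
  simp only [h₁, h₂, h₃] at e1 e2 e3 e4
  simp only [← he]
  linarith [h0 (stdVec a), h0 (stdVec i), h0 (stdVec j)]

end Polarization

theorem differentiableAt_matrix_det {E m : Type*} [NormedAddCommGroup E] [NormedSpace ℝ E]
    [Fintype m] [DecidableEq m] {A : E → Matrix m m ℝ} {y : E}
    (hA : ∀ i j, DifferentiableAt ℝ (fun z ↦ A z i j) y) :
    DifferentiableAt ℝ (fun z ↦ (A z).det) y := by
  simp only [Matrix.det_apply]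
  refine DifferentiableAt.fun_sum fun σ _ ↦ ?_
  simp only [Units.smul_def, zsmul_eq_mul]
  exact (differentiableAt_const _).mul 
    (HasFDerivAt.finsetProd fun i _ ↦ (hA (σ i) i).hasFDerivAt).differentiableAt

theorem differentiableAt_matrix_inv {E m : Type*} [NormedAddCommGroup E] [NormedSpace ℝ E]
    [Fintype m] [DecidableEq m] {A : E → Matrix m m ℝ} {y : E}
    (hA : ∀ i j, DifferentiableAt ℝ (fun z ↦ A z i j) y) (hy : (A y).det ≠ 0) (i j : m) :
    DifferentiableAt ℝ (fun z ↦ (A z)⁻¹ i j) y := by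
  simp only [Matrix.inv_def, Ring.inverse_eq_inv', Matrix.smul_apply, smul_eq_mul,
    Matrix.adjugate_apply]
  refine ((differentiableAt_matrix_det hA).inv hy).mul (differentiableAt_matrix_det fun k l ↦ ?_)
  by_cases hk : k = j
  · subst hk
    simp
  · simpa [Matrix.updateRow_ne hk] using hA k l

/-! ### Christoffel symbols and curvature at the centre of normal coordinates. -/

section NormalCoordinates
variable {n : ℕ} {M : Type*} [TopologicalSpace M] [ChartedSpace (Coord n) M]
  [IsManifold (𝓡 n) ∞ M] {g : RiemMetric n M} {φ : OpenPartialHomeomorph M (Coord n)}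

theorem metricMatrix_symm (y : Coord n) (i j : Fin n) :
    metricMatrix g φ y i j = metricMatrix g φ y j i :=
  g.symm _ _ _

theorem pd_pd_metricMatrix_swap (a b i j : Fin n) :
    pd a (pd b fun z ↦ metricMatrix g φ z i j) 0
      = pd a (pd b fun z ↦ metricMatrix g φ z j i) 0 := by
  simp only [metricMatrix_symm _ i j]

theorem christoffel_symm (i j k : Fin n) : christoffel g φ i j k = christoffel g φ j i k := by
  funext y
  have : (fun z ↦ metricMatrix g φ z i j) = fun z ↦ metricMatrix g φ z j i :=
    funext fun z ↦ metricMatrix_symm z i j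
  simp only [christoffel, this]
  congr 1
  exact Finset.sum_congr rfl fun l _ ↦ by ring

namespace IsNormalChart
variable (hφ : IsNormalChart g φ)
include hφ

theorem contDiffAt_metricMatrix (i j : Fin n) :
    ContDiffAt ℝ ∞ (fun y ↦ metricMatrix g φ y i j) 0 :=
  (contDiffOn_metricMatrix g hφ.mem_maximalAtlas i j).contDiffAt
    (φ.open_target.mem_nhds hφ.zero_mem_target)

theorem pd_pd_metricMatrix_comm (a b i j : Fin n) :
    pd a (pd b fun z ↦ metricMatrix g φ z i j) 0
      = pd b (pd a fun z ↦ metricMatrix g φ z i j) 0 :=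
  pd_comm (hφ.contDiffAt_metricMatrix i j) a b

theorem differentiableAt_pd_metricMatrix (a i j : Fin n) :
    DifferentiableAt ℝ (pd a fun y ↦ metricMatrix g φ y i j) 0 :=
  ((hφ.contDiffAt_metricMatrix i j).pd a).differentiableAt (by simp)

theorem differentiableAt_metricMatrix_inv (i j : Fin n) :
    DifferentiableAt ℝ (fun y ↦ (metricMatrix g φ y)⁻¹ i j) 0 :=
  differentiableAt_matrix_inv
    (fun i j ↦ (hφ.contDiffAt_metricMatrix i j).differentiableAt (by simp))
    (by simp [hφ.orthonormal]) i j

theorem differentiableAt_lowered_christoffel (i j l : Fin n) :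
    DifferentiableAt ℝ (fun y ↦ pd j (fun z ↦ metricMatrix g φ z i l) y
      + pd i (fun z ↦ metricMatrix g φ z j l) y - pd l (fun z ↦ metricMatrix g φ z i j) y) 0 :=
  ((hφ.differentiableAt_pd_metricMatrix _ _ _).add
    (hφ.differentiableAt_pd_metricMatrix _ _ _)).sub (hφ.differentiableAt_pd_metricMatrix _ _ _)

theorem differentiableAt_christoffel (i j k : Fin n) :
    DifferentiableAt ℝ (christoffel g φ i j k) 0 :=
  (DifferentiableAt.fun_sum fun _ _ ↦ (hφ.differentiableAt_metricMatrix_inv _ _).mul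
    (hφ.differentiableAt_lowered_christoffel _ _ _)).const_mul _

/-- A ray has zero acceleration, so only the Christoffel term remains. Validity for all small `t`
allows differentiation at `t = 0`. -/
theorem eventually_geodesic_equation (v : Coord n) (k : Fin n) :
    ∀ᶠ t : ℝ in nhds 0, ∑ i, ∑ j, christoffel g φ i j k (t • v) * v i * v j = 0 := by
  have hopen : IsOpen {t : ℝ | t • v ∈ φ.target} :=
    φ.open_target.preimage (continuous_id.smul continuous_const)
  filter_upwards [hopen.mem_nhds (by simpa using hφ.zero_mem_target)] with t ht
  have hd : deriv (fun t : ℝ ↦ t • v) = fun _ ↦ v := by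
    funext t
    simpa using ((hasDerivAt_id t).smul_const v).deriv
  simpa [hd] using (hφ.geodesic_ray v).equation t ht k

theorem christoffel_zero (i j k : Fin n) : christoffel g φ i j k 0 = 0 := by
  have h := add_swap_eq_zero_of_quadratic (T := fun i j ↦ christoffel g φ i j k 0)
    (fun v ↦ by simpa using (hφ.eventually_geodesic_equation v k).self_of_nhds) i j
  simp only [christoffel_symm j i] at h
  linarith

/-- Differentiating the ray equation at `t = 0` gives a vanishing cubic form in `v`. Its six-term
polarization is twice the cyclic sum, because `Γ` is symmetric in its lower indices. -/
theorem cyclic_sum_pd_christoffel (a i j k : Fin n) :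
    pd a (christoffel g φ i j k) 0 + pd i (christoffel g φ j a k) 0
      + pd j (christoffel g φ a i k) 0 = 0 := by
  have h := symmetrization_eq_zero_of_cubic (T := fun a i j ↦ pd a (christoffel g φ i j k) 0)
    (fun v ↦ ?_) a i j
  · simp only [christoffel_symm j i, christoffel_symm j a, christoffel_symm a i] at h ⊢
    linarith
  · have hd : HasDerivAt (fun t : ℝ ↦ ∑ i, ∑ j, christoffel g φ i j k (t • v) * v i * v j)
        (∑ i, ∑ j, (∑ a, v a * pd a (christoffel g φ i j k) 0) * v i * v j) 0 := by
      refine HasDerivAt.fun_sum fun i _ ↦ HasDerivAt.fun_sum fun j _ ↦ ?_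
      refine HasDerivAt.mul_const (HasDerivAt.mul_const ?_ _) _
      have hc : HasDerivAt (fun t : ℝ ↦ t • v) v 0 := by
        simpa using (hasDerivAt_id (0 : ℝ)).smul_const v
      rw [← fderiv_apply_eq_sum_pd]
      have hf : HasFDerivAt (christoffel g φ i j k) (fderiv ℝ (christoffel g φ i j k) 0)
          ((0 : ℝ) • v) := by
        simpa using (hφ.differentiableAt_christoffel i j k).hasFDerivAt
      exact hf.comp_hasDerivAt 0 hc
    have h0 : HasDerivAt (fun t : ℝ ↦ ∑ i, ∑ j, christoffel g φ i j k (t • v) * v i * v j) 0 0 :=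
      (hasDerivAt_const (0 : ℝ) (0 : ℝ)).congr_of_eventuallyEq
        (hφ.eventually_geodesic_equation v k)
    rw [← hd.unique h0]
    simp only [Finset.sum_mul]
    rw [Finset.sum_comm]
    refine Finset.sum_congr rfl fun i _ ↦ ?_
    rw [Finset.sum_comm]
    exact Finset.sum_congr rfl fun j _ ↦ Finset.sum_congr rfl fun a _ ↦ by ring

theorem pd_metricMatrix_zero (a i j : Fin n) : pd a (fun z ↦ metricMatrix g φ z i j) 0 = 0 := by
  have hs : ∀ i j, (fun z ↦ metricMatrix g φ z i j) = fun z ↦ metricMatrix g φ z j i :=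
    fun i j ↦ funext fun z ↦ metricMatrix_symm z i j
  have h : ∀ i j k, pd j (fun z ↦ metricMatrix g φ z i k) 0
      + pd i (fun z ↦ metricMatrix g φ z j k) 0 - pd k (fun z ↦ metricMatrix g φ z i j) 0 = 0 := by
    intro i j k
    have := hφ.christoffel_zero i j k
    rw [christoffel, hφ.orthonormal] at this
    simpa [Matrix.one_apply] using this
  have h1 := h a i j
  have h2 := h a j i
  rw [hs j i] at h2
  -- With lowered upper index, `∂_a g_ij = Γ_{ai,j} + Γ_{aj,i}`, and both terms vanish.
  linarith

/-- The derivative of the inverse metric multiplies first derivatives of `g`, which vanish at the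
centre, where the inverse metric is the identity. -/
theorem pd_christoffel (a i j k : Fin n) :
    pd a (christoffel g φ i j k) 0 = (1 / 2) * (pd a (pd j fun z ↦ metricMatrix g φ z i k) 0
      + pd a (pd i fun z ↦ metricMatrix g φ z j k) 0
      - pd a (pd k fun z ↦ metricMatrix g φ z i j) 0) := by
  have hc : christoffel g φ i j k = fun y ↦ (1 / 2) * ∑ l, (metricMatrix g φ y)⁻¹ k l *
    (pd j (fun z ↦ metricMatrix g φ z i l) y + pd i (fun z ↦ metricMatrix g φ z j l) y
      - pd l (fun z ↦ metricMatrix g φ z i j) y) := rfl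
  have hd : ∀ l, DifferentiableAt ℝ (fun y ↦ (metricMatrix g φ y)⁻¹ k l *
    (pd j (fun z ↦ metricMatrix g φ z i l) y + pd i (fun z ↦ metricMatrix g φ z j l) y
      - pd l (fun z ↦ metricMatrix g φ z i j) y)) 0 := fun l ↦
    (hφ.differentiableAt_metricMatrix_inv _ _).mul (hφ.differentiableAt_lowered_christoffel _ _ _)
  rw [hc, pd_const_mul (DifferentiableAt.fun_sum fun l _ ↦ hd l), pd_sum fun l _ ↦ hd l]
  congr 1
  have : ∀ l, pd a (fun y ↦ (metricMatrix g φ y)⁻¹ k l *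
    (pd j (fun z ↦ metricMatrix g φ z i l) y + pd i (fun z ↦ metricMatrix g φ z j l) y
      - pd l (fun z ↦ metricMatrix g φ z i j) y)) 0 = if k = l then
      (pd a (pd j fun z ↦ metricMatrix g φ z i l) 0
      + pd a (pd i fun z ↦ metricMatrix g φ z j l) 0
      - pd a (pd l fun z ↦ metricMatrix g φ z i j) 0) else 0 := by
    intro l
    rw [pd_mul (hφ.differentiableAt_metricMatrix_inv _ _)
      (hφ.differentiableAt_lowered_christoffel _ _ _), hφ.orthonormal,
      pd_sub ((hφ.differentiableAt_pd_metricMatrix _ _ _).fun_add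
        (hφ.differentiableAt_pd_metricMatrix _ _ _)) (hφ.differentiableAt_pd_metricMatrix _ _ _),
      pd_add (hφ.differentiableAt_pd_metricMatrix _ _ _) (hφ.differentiableAt_pd_metricMatrix _ _ _)]
    simp [hφ.pd_metricMatrix_zero, Matrix.one_apply]
  simp only [this, Finset.sum_ite_eq, Finset.mem_univ, if_true]

theorem riemann_zero (i j k l : Fin n) :
    riemann g φ i j k l 0 = pd k (christoffel g φ l j i) 0 - pd l (christoffel g φ k j i) 0 := by
  simp [riemann, hφ.christoffel_zero]

/-- In normal coordinates, `∂_a ∂_b g_ij = ∂_i ∂_j g_ab` at the centre. -/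
theorem pd_pd_metricMatrix_pair_symm (a b i j : Fin n) :
    pd a (pd b fun z ↦ metricMatrix g φ z i j) 0
      = pd i (pd j fun z ↦ metricMatrix g φ z a b) 0 := by
  have hs := pd_pd_metricMatrix_swap (g := g) (φ := φ)
  have hc := hφ.pd_pd_metricMatrix_comm
  have h1 := hφ.cyclic_sum_pd_christoffel a b i j
  have h2 := hφ.cyclic_sum_pd_christoffel a b j i
  have h3 := hφ.cyclic_sum_pd_christoffel a i j b
  have h4 := hφ.cyclic_sum_pd_christoffel b i j a
  simp only [hφ.pd_christoffel] at h1 h2 h3 h4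
  -- Sorting indices leaves six unknowns, paired as `∂_a∂_b g_ij` and `∂_i∂_j g_ab`. Adding the four
  -- cyclic identities two by two and subtracting leaves three times the desired difference.
  simp only [hc b a, hc i a, hc j a, hc i b, hc j b, hc j i, hs _ _ b a, hs _ _ i a, hs _ _ j a,
    hs _ _ i b, hs _ _ j b, hs _ _ j i] at h1 h2 h3 h4 ⊢
  linarith

theorem riemann_eq_sub (i j k l : Fin n) :
    riemann g φ i j k l 0 = pd k (pd j fun z ↦ metricMatrix g φ z i l) 0
      - pd k (pd i fun z ↦ metricMatrix g φ z j l) 0 := by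
  have hs := pd_pd_metricMatrix_swap (g := g) (φ := φ)
  have hc := hφ.pd_pd_metricMatrix_comm
  rw [hφ.riemann_zero, hφ.pd_christoffel, hφ.pd_christoffel]
  linarith [hφ.pd_pd_metricMatrix_pair_symm k j i l, hφ.pd_pd_metricMatrix_pair_symm k i j l,
    hc k l i j, hs k l i j, hc k l j i, hs k j i l, hs k i j l, hc i l k j, hc j l k i, hs i l k j,
    hs j l k i, hs l j k i, hs l i k j]

theorem riemann_antisymm (i j k l : Fin n) :
    riemann g φ i j k l 0 = -riemann g φ j i k l 0 := by
  rw [hφ.riemann_eq_sub, hφ.riemann_eq_sub]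
  ring

theorem riemann_pair_symm (i j k l : Fin n) :
    riemann g φ i j k l 0 = riemann g φ k l i j 0 := by
  have hs := pd_pd_metricMatrix_swap (g := g) (φ := φ)
  have hc := hφ.pd_pd_metricMatrix_comm
  rw [hφ.riemann_eq_sub, hφ.riemann_eq_sub]
  linarith [hφ.pd_pd_metricMatrix_pair_symm k j i l, hφ.pd_pd_metricMatrix_pair_symm k i j l,
    hs i l k j, hs j l k i, hc k i j l, hs i k j l]

/-- This is what replaces derivatives of Christoffel symbols by curvature: the part of `∂_aΓ_ij^k`
symmetric in `j, k` cancels. -/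
theorem pd_christoffel_sub_swap (a i j k : Fin n) :
    pd a (christoffel g φ i j k) 0 - pd a (christoffel g φ i k j) 0 = riemann g φ k j a i 0 := by
  have hs := pd_pd_metricMatrix_swap (g := g) (φ := φ)
  rw [hφ.riemann_eq_sub, hφ.pd_christoffel, hφ.pd_christoffel]
  linarith [hs a j i k, hs a k i j, hs a i j k]

end IsNormalChart
end NormalCoordinates

/-! ### Second moments and volume of the unit sphere. -/

section SphereIntegrals

open scoped Pointwise in
-- The surface measure of a set is a multiple of the volume of the cone over it, and a linear
-- isometry preserves cones and volume.
theorem map_toSphere_linearIsometryEquiv {E : Type*} [NormedAddCommGroup E]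
    [InnerProductSpace ℝ E] [FiniteDimensional ℝ E] [MeasurableSpace E] [BorelSpace E]
    (e : E ≃ₗᵢ[ℝ] E) :
    Measure.map (fun ξ : Metric.sphere (0 : E) 1 ↦ (⟨e ξ, by simp⟩ : Metric.sphere (0 : E) 1))
      (volume : Measure E).toSphere = (volume : Measure E).toSphere := by
  have hf : Continuous
      (fun ξ : Metric.sphere (0 : E) 1 ↦ (⟨e ξ, by simp⟩ : Metric.sphere (0 : E) 1)) :=
    (e.continuous.comp continuous_subtype_val).subtype_mk _
  refine Measure.ext fun s hs ↦ ?_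
  rw [Measure.map_apply hf.measurable hs, Measure.toSphere_apply' _ (hf.measurable hs),
    Measure.toSphere_apply' _ hs]
  congr 1
  rw [← (e.measurePreserving).measure_preimage_equiv (f := e.toMeasurableEquiv)
    (Set.Ioo (0 : ℝ) 1 • (Subtype.val '' s))]
  congr 1
  ext x
  simp only [Set.mem_smul, Set.mem_image, Set.mem_preimage, Subtype.exists, exists_and_right,
    exists_eq_right]
  constructor
  · rintro ⟨r, hr, y, ⟨hy, hys⟩, rfl⟩
    exact ⟨r, hr, e y, ⟨by simpa using hy, hys⟩, (map_smul e r y).symm⟩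
  · rintro ⟨r, hr, y, ⟨hy, hys⟩, h⟩
    refine ⟨r, hr, e.symm y, ⟨by simpa using hy, by simpa using hys⟩, ?_⟩
    rw [← map_smul, h]
    exact e.symm_apply_apply x

theorem integral_toSphere_comp_linearIsometryEquiv {E : Type*} [NormedAddCommGroup E]
    [InnerProductSpace ℝ E] [FiniteDimensional ℝ E] [MeasurableSpace E] [BorelSpace E]
    (e : E ≃ₗᵢ[ℝ] E) {F : E → ℝ} (hF : Continuous F) :
    ∫ ξ : Metric.sphere (0 : E) 1, F (e ξ) ∂(volume : Measure E).toSphere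
      = ∫ ξ : Metric.sphere (0 : E) 1, F ξ ∂(volume : Measure E).toSphere := by
  have hf : Continuous
      (fun ξ : Metric.sphere (0 : E) 1 ↦ (⟨e ξ, by simp⟩ : Metric.sphere (0 : E) 1)) :=
    (e.continuous.comp continuous_subtype_val).subtype_mk _
  conv_rhs => rw [← map_toSphere_linearIsometryEquiv e]
  rw [integral_map hf.aemeasurable]
  exact (hF.comp continuous_subtype_val).aestronglyMeasurable

variable {n : ℕ}

theorem integrable_coord_mul_coord (a b : Fin n) :
    Integrable (fun ξ : Metric.sphere (0 : Coord n) 1 ↦ (ξ : Coord n) a * (ξ : Coord n) b)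
      (volume : Measure (Coord n)).toSphere := by
  have h : Continuous fun ξ : Metric.sphere (0 : Coord n) 1 ↦
      (ξ : Coord n) a * (ξ : Coord n) b := by fun_prop
  exact (BoundedContinuousFunction.mkOfCompact ⟨_, h⟩).integrable _

theorem integral_coord_mul_coord_of_ne {a b : Fin n} (hab : a ≠ b) :
    ∫ ξ : Metric.sphere (0 : Coord n) 1, (ξ : Coord n) a * (ξ : Coord n) b
      ∂(volume : Measure (Coord n)).toSphere = 0 := by
  -- Reflecting the `a`-th coordinate changes the sign of the integrand.
  have h := integral_toSphere_comp_linearIsometryEquiv (E := Coord n)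
    (LinearIsometryEquiv.piLpCongrRight 2 fun i : Fin n ↦
      if i = a then LinearIsometryEquiv.neg ℝ else LinearIsometryEquiv.refl ℝ ℝ)
    (F := fun ξ ↦ ξ a * ξ b) (by fun_prop)
  simp [hab.symm, integral_neg] at h
  linarith

theorem integral_coord_mul_self_eq (a b : Fin n) :
    ∫ ξ : Metric.sphere (0 : Coord n) 1, (ξ : Coord n) a * (ξ : Coord n) a
      ∂(volume : Measure (Coord n)).toSphere
    = ∫ ξ : Metric.sphere (0 : Coord n) 1, (ξ : Coord n) b * (ξ : Coord n) b
      ∂(volume : Measure (Coord n)).toSphere := by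
  have h := integral_toSphere_comp_linearIsometryEquiv (E := Coord n)
    (LinearIsometryEquiv.piLpCongrLeft 2 ℝ ℝ (Equiv.swap a b))
    (F := fun ξ ↦ ξ b * ξ b) (by fun_prop)
  simpa [LinearIsometryEquiv.piLpCongrLeft_apply] using h

theorem integral_coord_mul_coord (a b : Fin n) :
    ∫ ξ : Metric.sphere (0 : Coord n) 1, (ξ : Coord n) a * (ξ : Coord n) b
      ∂(volume : Measure (Coord n)).toSphere
    = if a = b then (volume : Measure (Coord n)).toSphere.real Set.univ / n else 0 := by
  split_ifs with hab
  · subst hab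
    have hn : (n : ℝ) ≠ 0 := Nat.cast_ne_zero.2 (Fin.pos a).ne'
    -- The `n` equal integrals add up to the total measure because `∑ ξ_b² = 1` on the sphere.
    have hs : ∑ b, ∫ ξ : Metric.sphere (0 : Coord n) 1, (ξ : Coord n) b * (ξ : Coord n) b
        ∂(volume : Measure (Coord n)).toSphere
        = (volume : Measure (Coord n)).toSphere.real Set.univ := by
      rw [← integral_finsetSum _ fun b _ ↦ integrable_coord_mul_coord b b]
      have : ∀ ξ : Metric.sphere (0 : Coord n) 1,
          ∑ b, (ξ : Coord n) b * (ξ : Coord n) b = 1 := fun ξ ↦ by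
        have h1 := EuclideanSpace.real_norm_sq_eq (ξ : Coord n)
        rw [mem_sphere_zero_iff_norm.1 ξ.2] at h1
        simpa [sq] using h1.symm
      simp [this]
    rw [eq_div_iff hn, ← hs, Finset.sum_congr rfl fun b _ ↦ integral_coord_mul_self_eq b a]
    simp [mul_comm]
  · exact integral_coord_mul_coord_of_ne hab

theorem toSphere_real_univ {p : ℕ} (hp : 0 < p) (hn : n = 2 * p) :
    (volume : Measure (Coord n)).toSphere.real Set.univ
      = 2 * Real.pi ^ p / Real.Gamma p := by
  have : Nonempty (Fin n) := ⟨⟨0, by omega⟩⟩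
  have hG : Real.Gamma p ≠ 0 := (Real.Gamma_pos_of_pos (by exact_mod_cast hp)).ne'
  have hp' : (p : ℝ) ≠ 0 := by exact_mod_cast hp.ne'
  rw [Measure.toSphere_real_apply_univ, Measure.real, EuclideanSpace.volume_ball]
  have h1 : Real.Gamma ((n : ℝ) / 2 + 1) = p * Real.Gamma p := by
    rw [hn, ← Real.Gamma_add_one hp']
    congr 1
    push_cast
    ring
  have h2 : Real.sqrt Real.pi ^ n = Real.pi ^ p := by
    rw [hn, pow_mul, Real.sq_sqrt Real.pi_pos.le]
  simp only [Fintype.card_fin, finrank_euclideanSpace, h1, h2]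
  rw [ENNReal.toReal_mul, ENNReal.toReal_ofReal
    (div_nonneg (by positivity) (mul_nonneg (by positivity) (Real.Gamma_pos_of_pos
      (by exact_mod_cast hp)).le))]
  simp only [ENNReal.ofReal_one, one_pow, ENNReal.toReal_one, one_mul]
  rw [hn]
  push_cast
  field_simp

end SphereIntegrals

/-! ### Residues of the two kinds of symbol. -/

section Residue
variable {n p : ℕ} {S : Type*} [AddCommGroup S] [Module ℂ S]

theorem superTrace_real_smul (γ : Fin n → Module.End ℂ S) (r : ℝ) (A : Module.End ℂ S) :
    superTrace p γ (r • A) = r * superTrace p γ A := by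
  rw [← superTraceₗ_apply, ← superTraceₗ_apply, ← Complex.coe_smul, map_smul, smul_eq_mul]

theorem sphere_integral_factor (hp : 0 < p) (hn : n = 2 * p) :
    1 / (2 * (Real.pi : ℂ)) ^ n
        * (((volume : Measure (Coord n)).toSphere.real Set.univ : ℝ) : ℂ)
      = 2 / (Real.Gamma p * 2 ^ (2 * p) * (Real.pi : ℂ) ^ p) := by
  have hG : (Real.Gamma p : ℂ) ≠ 0 :=
    Complex.ofReal_ne_zero.2 (Real.Gamma_pos_of_pos (by exact_mod_cast hp)).ne'
  have hpi : (Real.pi : ℂ) ≠ 0 := Complex.ofReal_ne_zero.2 Real.pi_ne_zero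
  rw [toSphere_real_univ hp hn, hn]
  push_cast
  rw [mul_pow, two_mul p, pow_add (Real.pi : ℂ)]
  field_simp

theorem sres_normPowSymbol (hp : 0 < p) (hn : n = 2 * p) (γ : Fin n → Module.End ℂ S) {d : ℤ}
    (hd : d = -(n : ℤ)) (A : Module.End ℂ S) :
    sres p γ (normPowSymbol d A)
      = 2 / (Real.Gamma p * 2 ^ (2 * p) * (Real.pi : ℂ) ^ p) * superTrace p γ A := by
  rw [← sphere_integral_factor hp hn, sres]
  simp [normPowSymbol, hd, mul_assoc]

theorem sres_quadNormPowSymbol (hp : 0 < p) (hn : n = 2 * p) (γ : Fin n → Module.End ℂ S) {d : ℤ}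
    (hd : d + 2 = -(n : ℤ)) (B : Fin n → Fin n → Module.End ℂ S) :
    sres p γ (quadNormPowSymbol d B)
      = 2 / (Real.Gamma p * 2 ^ (2 * p) * (Real.pi : ℂ) ^ p) / n
        * superTrace p γ (∑ a, B a a) := by
  have h : ∀ ξ : Metric.sphere (0 : Coord n) 1,
      superTrace p γ ((quadNormPowSymbol d B).comp (-(n : ℤ)) ξ)
        = ∑ a, ∑ b, (((ξ : Coord n) a * (ξ : Coord n) b : ℝ) : ℂ) * superTrace p γ (B a b) := by
    intro ξ
    simp only [quadNormPowSymbol, hd, if_true, mem_sphere_zero_iff_norm.1 ξ.2, one_zpow, mul_one]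
    simp only [← superTraceₗ_apply, map_sum]
    simp only [superTraceₗ_apply, superTrace_real_smul]
  have hi : ∀ a b, Integrable (fun ξ : Metric.sphere (0 : Coord n) 1 ↦
      (((ξ : Coord n) a * (ξ : Coord n) b : ℝ) : ℂ) * superTrace p γ (B a b))
      (volume : Measure (Coord n)).toSphere := fun a b ↦
    ((integrable_coord_mul_coord a b).ofReal).mul_const _
  have hc : ∀ a b, ∫ ξ : Metric.sphere (0 : Coord n) 1,
      (((ξ : Coord n) a * (ξ : Coord n) b : ℝ) : ℂ) ∂(volume : Measure (Coord n)).toSphere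
      = ((if a = b then (volume : Measure (Coord n)).toSphere.real Set.univ / n else 0 : ℝ) : ℂ) :=
    fun a b ↦ by
      rw [← integral_coord_mul_coord]
      exact integral_ofReal
  rw [← sphere_integral_factor hp hn, sres]
  simp only [h]
  rw [integral_finsetSum _ fun a _ ↦ integrable_finsetSum _ fun b _ ↦ hi a b]
  simp only [integral_finsetSum _ fun b _ ↦ hi _ b, integral_mul_const, hc]
  simp only [← superTraceₗ_apply, map_sum, Finset.mul_sum]
  refine Finset.sum_congr rfl fun a _ ↦ ?_
  rw [Finset.sum_eq_single a (fun b _ hb ↦ by simp [hb.symm]) (by simp), if_pos rfl]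
  push_cast
  ring

end Residue

/-! ### Sums over multi-indices. -/

section WordSums

theorem sum_arrow_prod {κ α β A : Type*} [Fintype κ] [DecidableEq κ] [Fintype α] [Fintype β]
    [AddCommMonoid A] (f : (κ → α × β) → A) :
    ∑ x, f x = ∑ u : κ → α, ∑ v : κ → β, f fun r ↦ (u r, v r) := by
  rw [← (Equiv.arrowProdEquivProdArrow κ (fun _ ↦ α) fun _ ↦ β).symm.sum_comp,
    Fintype.sum_prod_type]
  rfl

theorem prod_ofFn_smul {R A : Type*} [CommSemiring R] [Semiring A] [Algebra R A] {q : ℕ}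
    (c : Fin q → R) (M : Fin q → A) :
    (List.ofFn fun r ↦ c r • M r).prod = (∏ r, c r) • (List.ofFn M).prod := by
  induction q with
  | zero => simp
  | succ q ih =>
    rw [List.ofFn_succ, List.prod_cons, ih, Fin.prod_univ_succ, List.ofFn_succ, List.prod_cons,
      smul_mul_smul_comm]

end WordSums

/-! ### From Christoffel derivatives to the curvature polynomial. -/

section Curvature
variable {n : ℕ}

/-- The element `∑_{a,i} (∑_{k,j} R_kjai x_k x_j)²` of the free algebra. -/
noncomputable def curvatureWord (R : Fin n → Fin n → Fin n → Fin n → ℝ) :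
    FreeAlgebra ℂ (Fin n) :=
  ∑ a, ∑ i, (∑ k, ∑ j, (R k j a i : ℂ) • (FreeAlgebra.ι ℂ k * FreeAlgebra.ι ℂ j)) ^ 2

theorem curvatureWord_mem (R : Fin n → Fin n → Fin n → Fin n → ℝ) :
    curvatureWord R ∈ Submodule.span ℂ (Set.range (FreeAlgebra.ι ℂ : Fin n → _)) ^ 4 := by
  rw [show (4 : ℕ) = 2 * 2 from rfl, pow_mul]
  have h : ∀ k, FreeAlgebra.ι ℂ k ∈ Submodule.span ℂ (Set.range (FreeAlgebra.ι ℂ : Fin n → _)) :=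
    fun k ↦ Submodule.subset_span ⟨k, rfl⟩
  refine Submodule.sum_mem _ fun a _ ↦ Submodule.sum_mem _ fun i _ ↦ Submodule.pow_mem_pow _ ?_ 2
  refine Submodule.sum_mem _ fun k _ ↦ Submodule.sum_mem _ fun j _ ↦ Submodule.smul_mem _ _ ?_
  rw [sq]
  exact Submodule.mul_mem_mul (h k) (h j)

theorem lift_curvatureWord {A : Type*} [Ring A] [Algebra ℂ A] (η : Fin n → A)
    (R : Fin n → Fin n → Fin n → Fin n → ℝ) :
    FreeAlgebra.lift ℂ η (curvatureWord R)
      = ∑ a, ∑ i, (∑ k, ∑ j, (R k j a i : ℂ) • (η k * η j)) ^ 2 := by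
  simp only [curvatureWord, map_sum, map_pow, map_smul, map_mul, FreeAlgebra.lift_ι_apply]

variable {S : Type*} [AddCommGroup S] [Module ℂ S]

theorem sum_smul_spinSigma (γ : Fin n → Module.End ℂ S) {D R : Fin n → Fin n → ℝ}
    (hR : ∀ j k, D j k - D k j = R k j) :
    ∑ j, ∑ k, D j k • spinSigma γ k j = (1 / 8 : ℂ) • ∑ k, ∑ j, (R k j : ℂ) • (γ k * γ j) := by
  -- Renaming the indices in the second half of the commutator `[γ_k, γ_j]` moves the
  -- antisymmetrization from `γ` to `D`.
  have h1 : ∑ j, ∑ k, (D j k : ℂ) • (γ j * γ k) = ∑ j, ∑ k, (D k j : ℂ) • (γ k * γ j) :=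
    Finset.sum_comm
  have h2 : ∑ j, ∑ k, D j k • spinSigma γ k j
      = (1 / 8 : ℂ) • (∑ j, ∑ k, (D j k : ℂ) • (γ k * γ j)
        - ∑ j, ∑ k, (D j k : ℂ) • (γ j * γ k)) := by
    simp only [← Finset.sum_sub_distrib, Finset.smul_sum]
    refine Finset.sum_congr rfl fun j _ ↦ Finset.sum_congr rfl fun k _ ↦ ?_
    rw [spinSigma, ← Complex.coe_smul, smul_comm, smul_sub]
  rw [h2, h1, Finset.sum_comm (s := Finset.univ) (f := fun k j ↦ (R k j : ℂ) • (γ k * γ j))]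
  simp only [← Finset.sum_sub_distrib, ← sub_smul, ← hR]
  push_cast
  rfl

/-- The endomorphism `∂_aΓ_ij^k ∂_aΓ_im^l σ_kj σ_lm`. -/
noncomputable def christoffelEnd (dΓ : Fin n → Fin n → Fin n → Fin n → ℝ)
    (σ : Fin n → Fin n → Module.End ℂ S) : Module.End ℂ S :=
  ∑ a, ∑ i, ∑ j, ∑ k, ∑ m, ∑ l, (dΓ a i j k * dΓ a i m l) • (σ k j * σ l m)

/-- For fixed `a, i` the sums over `(j, k)` and over `(m, l)` are the same element, so the summand
is a square; each factor carries `1/8`. -/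
theorem christoffelEnd_spinSigma (γ : Fin n → Module.End ℂ S)
    {dΓ R : Fin n → Fin n → Fin n → Fin n → ℝ}
    (hR : ∀ a i j k, dΓ a i j k - dΓ a i k j = R k j a i) :
    christoffelEnd dΓ (spinSigma γ)
      = (1 / 64 : ℂ) • FreeAlgebra.lift ℂ γ (curvatureWord R) := by
  rw [lift_curvatureWord, christoffelEnd, Finset.smul_sum]
  refine Finset.sum_congr rfl fun a _ ↦ ?_
  rw [Finset.smul_sum]
  refine Finset.sum_congr rfl fun i _ ↦ ?_
  have h := sum_smul_spinSigma γ (D := fun j k ↦ dΓ a i j k) (R := fun k j ↦ R k j a i) (hR a i)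
  have h64 : (1 / 64 : ℂ) = (1 / 8) ^ 2 := by norm_num
  rw [h64, ← smul_pow, ← h, sq]
  simp only [Finset.sum_mul]
  simp only [Finset.mul_sum, smul_mul_smul_comm]

theorem christoffelEnd_pow (dΓ : Fin n → Fin n → Fin n → Fin n → ℝ)
    (σ : Fin n → Fin n → Module.End ℂ S) (q : ℕ) :
    ∑ a : Fin q → Fin n, ∑ i : Fin q → Fin n, ∑ j : Fin q → Fin n,
      ∑ k : Fin q → Fin n, ∑ m : Fin q → Fin n, ∑ l : Fin q → Fin n,
        (∏ r, dΓ (a r) (i r) (j r) (k r) * dΓ (a r) (i r) (m r) (l r)) •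
          (List.ofFn fun r ↦ σ (k r) (j r) * σ (l r) (m r)).prod
      = christoffelEnd dΓ σ ^ q := by
  have h : christoffelEnd dΓ σ = ∑ x : Fin n × Fin n × Fin n × Fin n × Fin n × Fin n,
      (dΓ x.1 x.2.1 x.2.2.1 x.2.2.2.1 * dΓ x.1 x.2.1 x.2.2.2.2.1 x.2.2.2.2.2) •
        (σ x.2.2.2.1 x.2.2.1 * σ x.2.2.2.2.2 x.2.2.2.2.1) := by
    simp only [Fintype.sum_prod_type, christoffelEnd]
  rw [h, sum_pow_eq_sum_prod_ofFn]
  simp only [sum_arrow_prod, prod_ofFn_smul]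

end Curvature

/-! ### The geometric identity at the centre. -/

section Geometry
variable {n : ℕ} {M : Type*} [TopologicalSpace M] [ChartedSpace (Coord n) M]
  [IsManifold (𝓡 n) ∞ M] {g : RiemMetric n M} {φ : OpenPartialHomeomorph M (Coord n)}
  {S : Type*} [AddCommGroup S] [Module ℂ S]

/-- Pair symmetry moves the matrix indices into the form slots. Antisymmetry turns `R^a_i ∧ R^i_a`
into minus a square, and the two factors `1/2` give `1/4`. -/
theorem IsNormalChart.trRR_eq (hφ : IsNormalChart g φ) :
    trRR g φ 0 = (-1 / 4 : ℂ) •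
      FreeAlgebra.lift ℂ (dxForm φ 0) (curvatureWord fun i j k l ↦ riemann g φ i j k l 0) := by
  have h1 : ∀ i j, curvatureForm g φ 0 i j
      = (1 / 2 : ℂ) • ∑ k, ∑ l, (riemann g φ k l i j 0 : ℂ) • (dxForm φ 0 k * dxForm φ 0 l) := by
    intro i j
    simp only [curvatureForm, Matrix.of_apply, hφ.riemann_pair_symm i j]
  have h2 : ∀ i j, curvatureForm g φ 0 j i = -curvatureForm g φ 0 i j := by
    intro i j
    simp only [curvatureForm, Matrix.of_apply, hφ.riemann_antisymm j i, Complex.ofReal_neg,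
      neg_smul, Finset.sum_neg_distrib, smul_neg]
  rw [lift_curvatureWord, trRR, Matrix.trace, Finset.smul_sum]
  refine Finset.sum_congr rfl fun a _ ↦ ?_
  rw [Matrix.diag_apply, Matrix.mul_apply, Finset.smul_sum]
  refine Finset.sum_congr rfl fun i _ ↦ ?_
  rw [h2 a i, h1, mul_neg, smul_mul_smul_comm, ← neg_smul, sq]
  norm_num

theorem cliffordForm_coordVec (y : Coord n) (i : Fin n) :
    cliffordForm g (φ.symm y) (coordVec φ y i) = -metricMatrix g φ y i i := by
  rfl

theorem polar_cliffordForm_coordVec (y : Coord n) (i j : Fin n) :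
    QuadraticMap.polar (cliffordForm g (φ.symm y)) (coordVec φ y i) (coordVec φ y j)
      = -(2 * metricMatrix g φ y i j) := by
  have h : ∀ v w, QuadraticMap.polar (cliffordForm g (φ.symm y)) v w
      = -(g.inner (φ.symm y) v w + g.inner (φ.symm y) w v) := by
    intro v w
    simp [cliffordForm, QuadraticMap.polar]
    ring
  rw [h, g.symm _ (coordVec φ y j), two_mul]
  rfl

theorem IsNormalChart.gammaMatrix_mul_self (hφ : IsNormalChart g φ)
    (ρ : CliffordAt g (φ.symm 0) →ₐ[ℝ] Module.End ℂ S) (i : Fin n) :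
    gammaMatrix g φ 0 ρ i * gammaMatrix g φ 0 ρ i = -1 := by
  rw [gammaMatrix, CliffordAlgebra.comp_ι_sq_scalar, cliffordForm_coordVec, hφ.orthonormal]
  simp

theorem IsNormalChart.gammaMatrix_anticomm (hφ : IsNormalChart g φ)
    (ρ : CliffordAt g (φ.symm 0) →ₐ[ℝ] Module.End ℂ S) {i j : Fin n} (hij : i ≠ j) :
    gammaMatrix g φ 0 ρ i * gammaMatrix g φ 0 ρ j
      = -(gammaMatrix g φ 0 ρ j * gammaMatrix g φ 0 ρ i) := by
  rw [eq_neg_iff_add_eq_zero, gammaMatrix, gammaMatrix, ← map_mul ρ, ← map_mul ρ, ← map_add ρ,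
    CliffordAlgebra.ι_mul_ι_add_swap, polar_cliffordForm_coordVec, hφ.orthonormal,
    Matrix.one_apply_ne hij]
  simp

/-- The super trace of the `q`-th power of `∂_aΓ_ij^k ∂_aΓ_im^l σ_kj σ_lm` in dimension `4q`. -/
theorem IsNormalChart.superTrace_christoffelEnd_pow (hφ : IsNormalChart g φ)
    (ρ : CliffordAt g (φ.symm 0) →ₐ[ℝ] Module.End ℂ S) {p q : ℕ} (hn : n = 4 * q)
    (hp : p = 2 * q) (hS : Module.finrank ℂ S = 2 ^ p)
    {dΓ : Fin n → Fin n → Fin n → Fin n → ℝ}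
    (hdΓ : ∀ a i j k, dΓ a i j k = pd a (christoffel g φ i j k) 0) :
    superTrace p (gammaMatrix g φ 0 ρ)
        (christoffelEnd dΓ (spinSigma (gammaMatrix g φ 0 ρ)) ^ q) • dxVol φ 0
      = (1 / 2 ^ p : ℂ) • trRR g φ 0 ^ q := by
  have hanti : ∀ i j, i ≠ j → gammaMatrix g φ 0 ρ i * gammaMatrix g φ 0 ρ j
      = -(gammaMatrix g φ 0 ρ j * gammaMatrix g φ 0 ρ i) := fun i j ↦ hφ.gammaMatrix_anticomm ρ
  have hsq := hφ.gammaMatrix_mul_self ρ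
  set R : Fin n → Fin n → Fin n → Fin n → ℝ := fun i j k l ↦ riemann g φ i j k l 0
  have hA := christoffelEnd_spinSigma (gammaMatrix g φ 0 ρ) (dΓ := dΓ) (R := R) fun a i j k ↦ by
    rw [hdΓ, hdΓ]
    exact hφ.pd_christoffel_sub_swap a i j k
  have hw : curvatureWord R ^ q
      ∈ Submodule.span ℂ (Set.range (FreeAlgebra.ι ℂ : Fin n → _)) ^ n := by
    have h := Submodule.pow_mem_pow _ (curvatureWord_mem R) q
    rwa [← pow_mul, ← hn] at h
  have key := superTrace_lift_smul (θ := dxForm φ 0) hanti hsq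
    (fun i j _ ↦ eq_neg_of_add_eq_zero_left (ExteriorAlgebra.ι_add_mul_swap _ _))
    (fun i ↦ ExteriorAlgebra.ι_sq_zero _) ⟨2 * q, by omega⟩ p hw
  rw [superTrace_prod_ofFn hanti hsq hn hp hS, map_pow, map_pow] at key
  rw [hA, smul_pow, hφ.trRR_eq, smul_pow, ← superTraceₗ_apply, map_smul, superTraceₗ_apply,
    smul_assoc, dxVol, key, smul_smul, smul_smul, hp, pow_mul]
  congr 1
  -- The bases agree: `(1/64)(-4) = (1/4)(-1/4)`.
  rw [← one_div_pow, ← mul_pow, ← mul_pow]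
  norm_num

end Geometry
end SuperResidue

theorem mainTheorem8 {n p : ℕ} (hn : n = 2 * p)
    {M : Type*} [TopologicalSpace M] [ChartedSpace (SuperResidue.Coord n) M]
    [IsManifold (𝓡 n) ∞ M]
    -- a Riemannian metric, and normal coordinates centred at the point `φ.symm 0`
    (g : SuperResidue.RiemMetric n M)
    (φ : OpenPartialHomeomorph M (SuperResidue.Coord n))
    (hφ : SuperResidue.IsNormalChart g φ)
    -- the spinor module at the centre: the complex Clifford module of dimension `2 ^ p`
    {S : Type*} [AddCommGroup S] [Module ℂ S]
    (ρ : SuperResidue.CliffordAt g (φ.symm 0) →ₐ[ℝ] Module.End ℂ S)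
    (hS : Module.finrank ℂ S = 2 ^ p)
    -- `γ j`, `σ i j` and `dΓ a i j k = ∂_a Γ_ij^k` at the centre
    (γ : Fin n → Module.End ℂ S) (hγ : γ = SuperResidue.gammaMatrix g φ 0 ρ)
    (σ : Fin n → Fin n → Module.End ℂ S) (hσ : σ = SuperResidue.spinSigma γ)
    (dΓ : Fin n → Fin n → Fin n → Fin n → ℝ)
    (hdΓ : ∀ a i j k, dΓ a i j k = SuperResidue.pd a (SuperResidue.christoffel g φ i j k) 0) :
    -- dimension four
    (n = 4 →
      SuperResidue.sres p γ (SuperResidue.normPowSymbol (-4)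
          (∑ a, ∑ i, ∑ j, ∑ k, ∑ m, ∑ l, (dΓ a i j k * dΓ a i m l) • (σ k j * σ l m)))
            • SuperResidue.dxVol φ 0
        = (1 / (32 * (Real.pi : ℂ) ^ 2)) • SuperResidue.trRR g φ 0 ∧
      SuperResidue.sres p γ (SuperResidue.quadNormPowSymbol (-6) fun a b ↦
          ∑ i, ∑ j, ∑ k, ∑ m, ∑ l, (dΓ a i j k * dΓ b i m l) • (σ k j * σ l m))
            • SuperResidue.dxVol φ 0
        = (1 / (4 * 32 * (Real.pi : ℂ) ^ 2)) • SuperResidue.trRR g φ 0) ∧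
    -- dimension `n = 2 p = 4 q`
    (∀ q : ℕ, 0 < q → n = 4 * q →
      SuperResidue.sres p γ (SuperResidue.normPowSymbol (-(2 * (p : ℤ)))
          (∑ a : Fin q → Fin n, ∑ i : Fin q → Fin n, ∑ j : Fin q → Fin n,
            ∑ k : Fin q → Fin n, ∑ m : Fin q → Fin n, ∑ l : Fin q → Fin n,
              (∏ r, dΓ (a r) (i r) (j r) (k r) * dΓ (a r) (i r) (m r) (l r)) •
                (List.ofFn fun r ↦ σ (k r) (j r) * σ (l r) (m r)).prod))
            • SuperResidue.dxVol φ 0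
        = (1 / ((Real.Gamma p : ℂ) * 2 ^ (3 * p - 1) * (Real.pi : ℂ) ^ p)) •
            SuperResidue.trRR g φ 0 ^ q) := by
  subst hγ hσ
  have hone : SuperResidue.christoffelEnd dΓ
      (SuperResidue.spinSigma (SuperResidue.gammaMatrix g φ 0 ρ))
      = ∑ a, ∑ i, ∑ j, ∑ k, ∑ m, ∑ l, (dΓ a i j k * dΓ a i m l) •
        (SuperResidue.spinSigma (SuperResidue.gammaMatrix g φ 0 ρ) k j
          * SuperResidue.spinSigma (SuperResidue.gammaMatrix g φ 0 ρ) l m) := rfl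
  refine ⟨fun h4 ↦ ?_, fun q hq hnq ↦ ?_⟩
  · have hp : p = 2 := by omega
    -- Both four-dimensional claims use the case `q = 1`.
    have key := hφ.superTrace_christoffelEnd_pow ρ (q := 1) h4 hp hS hdΓ
    rw [pow_one, pow_one] at key
    have hG : Real.Gamma (p : ℝ) = 1 := by
      rw [hp]
      exact_mod_cast Real.Gamma_two
    constructor
    · rw [SuperResidue.sres_normPowSymbol (by omega) hn _ (by rw [h4]; rfl), ← hone, mul_smul, key,
        smul_smul, hG, hp]
      congr 1
      push_cast
      field_simp
      norm_num
    · rw [SuperResidue.sres_quadNormPowSymbol (by omega) hn _ (by rw [h4]; rfl), ← hone, mul_smul,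
        key, smul_smul, hG, hp]
      congr 1
      rw [h4]
      push_cast
      field_simp
      norm_num
  · have hp : p = 2 * q := by omega
    rw [SuperResidue.sres_normPowSymbol (by omega) hn _ (by rw [hn]; push_cast; rfl),
      SuperResidue.christoffelEnd_pow, mul_smul,
      hφ.superTrace_christoffelEnd_pow ρ hnq hp hS hdΓ, smul_smul]
    congr 1
    -- The sphere factor `2 / 2^{2p}` times the algebraic factor `2^{-p}`; the truncated exponent
    -- `3p - 1` is harmless since `p > 0`.
    have h2 : (2 : ℂ) ^ (2 * p) * 2 ^ p = 2 * 2 ^ (3 * p - 1) := by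
      rw [← pow_add, ← pow_succ']
      congr 1
      omega
    rw [div_mul_div_comm, mul_one, mul_right_comm, mul_assoc _ ((2 : ℂ) ^ (2 * p)), h2]
    have hG : (Real.Gamma p : ℂ) ≠ 0 :=
      Complex.ofReal_ne_zero.2 (Real.Gamma_pos_of_pos (by exact_mod_cast (by omega : 0 < p))).ne'
    field_simp
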